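/- **Proposition 3.8 (Upper bound on minimal energy).** Let $0<\alpha\le 1$. For a Lebesgue measurable set $F\subset\mathbb R^2$ let $$E(F)=P(F)+V(F),\qquad V(F)=\int_F\int_F\frac{dx\,dy}{|x-y|^{\alpha}},$$ where $P(F)=\sup\{\int_F\nabla\cdot\phi\,dx:\ \phi\in C^1_c(\mathbb R^2;\mathbb R^2),\ |\phi|\le 1\}$ is the De Giorgi perimeter. A minimizer of $E$ with mass $m$ is a Lebesgue measurable set $\Omega$ with $|\Omega|=m$ and $E(\Omega)\le E(F)$ for every Lebesgue measurable $F$ with $|F|=m$. Let $B_R$ denote the open disk of radius $R$ centered at the origin, and set $$m_{c1}=\pi\left(\frac{(\sqrt2-1)\,\Gamma(2-\frac{\alpha}{2})\,\Gamma(3-\frac{\alpha}{2})}{\pi\,(1-2^{\frac{\alpha-2}{2}})\,\Gamma(2-\alpha)}\right)^{\frac{2}{3-\alpha}},\qquad R_{c1}=\sqrt{m_{c1}/\pi},\qquad \rho_{c1}=\frac{2\pi R_{c1}+V(B_1)\,R_{c1}^{4-\alpha}}{\pi R_{c1}^2}.$$ If $m\ge m_{c1}$ and $\Omega$ is a minimizer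 of $E$ with mass $m$, then $$E(\Omega)\le m\,\rho_{c1}=\frac{m}{m_{c1}}\,E\bigl(B_{\sqrt{m_{c1}/\pi}}\bigr).$$ -/

import Mathlib

open MeasureTheory
open scoped ENNReal

noncomputable section

namespace RieszIsoperimetric

/-- The Euclidean plane. -/
abbrev Plane : Type := EuclideanSpace ℝ (Fin 2)

/-- The divergence of a vector field on the plane. -/
def divergence (φ : Plane → Plane) (x : Plane) : ℝ :=
  ∑ i : Fin 2, fderiv ℝ φ x (EuclideanSpace.single i 1) i

/-- The admissible fields in De Giorgi's definition of the perimeter: compactly supported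
`C¹` vector fields with values in the closed unit disk. -/
def IsTestField (φ : Plane → Plane) : Prop :=
  ContDiff ℝ 1 φ ∧ HasCompactSupport φ ∧ ∀ x, ‖φ x‖ ≤ 1

/-- De Giorgi's perimeter, with values in `[0, ∞]`. The zero field is admissible, so
replacing negative integrals by `0` does not change the supremum. -/
def perimeter (F : Set Plane) : ℝ≥0∞ :=
  ⨆ (φ : Plane → Plane) (_ : IsTestField φ), ENNReal.ofReal (∫ x in F, divergence φ x)

/-- The non-local repulsive energy `∫_F ∫_F |x - y|^(-α) dx dy`, with values in `[0, ∞]`. -/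
def interaction (α : ℝ) (F : Set Plane) : ℝ≥0∞ :=
  ∫⁻ y in F, ∫⁻ x in F, ENNReal.ofReal (1 / ‖x - y‖ ^ α)

/-- The total energy. -/
def energy (α : ℝ) (F : Set Plane) : ℝ≥0∞ :=
  perimeter F + interaction α F

/-- `Ω` is a minimizer of the energy with mass `m`, among all Lebesgue measurable sets
(sets that are measurable with respect to the completion of `volume`). -/
structure IsMinimizer (α m : ℝ) (Ω : Set Plane) : Prop where
  measurable : NullMeasurableSet Ω volume
  mass : volume Ω = ENNReal.ofReal m
  minimal : ∀ F : Set Plane, NullMeasurableSet F volume → volume F = ENNReal.ofReal m →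
    energy α Ω ≤ energy α F

/-- The critical mass `m_{c1}(α)`. -/
def criticalMass (α : ℝ) : ℝ :=
  Real.pi *
    (((√2 - 1) * Real.Gamma (2 - α / 2) * Real.Gamma (3 - α / 2)) /
      (Real.pi * (1 - (2 : ℝ) ^ ((α - 2) / 2)) * Real.Gamma (2 - α))) ^ (2 / (3 - α))

/-- `R_{c1} = √(m_{c1} / π)`. -/
def criticalRadius (α : ℝ) : ℝ := √(criticalMass α / Real.pi)

/-- `V_0(α)`, the interaction energy of the unit disk. -/
def unitDiskInteraction (α : ℝ) : ℝ := (interaction α (Metric.ball (0 : Plane) 1)).toReal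

/-- `E_1(R) = 2 π R + V_0 R^(4 - α)`. -/
def diskEnergy (α R : ℝ) : ℝ := 2 * Real.pi * R + unitDiskInteraction α * R ^ (4 - α)

/-- `ρ_{c1} = E_1(R_{c1}) / (π R_{c1}²)`. -/
def criticalDensity (α : ℝ) : ℝ :=
  diskEnergy α (criticalRadius α) / (Real.pi * criticalRadius α ^ 2)

end RieszIsoperimetric

end

open MeasureTheory
open scoped ENNReal

noncomputable section

namespace RieszIsoperimetric

open Set Metric Module Filter Topology

/-! The competitors are `n` equal disks of total mass `m`, placed on a line with gaps `D`. As `D`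
tends to infinity the interactions between different disks vanish because `α > 0`, so a minimizer
costs at most `n` times the energy of one disk (`energy_le_of_isMinimizer`).

It remains to choose `n` well. As a function of the logarithm of the radius, the energy of a disk
per unit mass is a positive combination of exponentials, hence convex (`diskEnergy_div_le_max`). The
critical radius `R` is the one at which this density takes the same value at `R / √2` and at `R`
(`diskEnergy_criticalRadius_div_sqrt_two`), so between them it stays below `criticalDensity`. With
`n = ⌈m / criticalMass α⌉`, each disk has mass between half the critical mass and the critical mass,
so its radius lies in that range.

The critical mass is given by Gamma functions, while the energy contains the interaction of the unit
disk as an integral; `interaction_ball` evaluates it and links the two. -/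

/-! ### Closed form of the interaction energy of a disk -/

/-- Integration of a radial function in polar coordinates. -/
lemma lintegral_fun_norm {f : ℝ → ℝ≥0∞} (hf : Measurable f) :
    ∫⁻ x : Plane, f ‖x‖ = ENNReal.ofReal (2 * Real.pi) *
      ∫⁻ t in Ioi (0 : ℝ), ENNReal.ofReal t * f t := by
  calc
    ∫⁻ x : Plane, f ‖x‖ = ∫⁻ x : ({(0 : Plane)}ᶜ : Set Plane), f ‖x.1‖ ∂(volume.comap Subtype.val) := by
      rw [lintegral_subtype_comap (measurableSet_singleton _).compl (fun x ↦ f ‖x‖),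
        restrict_compl_singleton]
    _ = ∫⁻ x : sphere (0 : Plane) 1 × Ioi (0 : ℝ), f x.2.1
          ∂(volume : Measure Plane).toSphere.prod (.volumeIoiPow (finrank ℝ Plane - 1)) := by
      simpa using (volume : Measure Plane).measurePreserving_homeomorphUnitSphereProd.lintegral_comp
        (f := f ∘ Subtype.val ∘ Prod.snd) (by fun_prop)
    _ = (volume : Measure Plane).toSphere univ *
          ∫⁻ x : Ioi (0 : ℝ), f x ∂.volumeIoiPow (finrank ℝ Plane - 1) := by
      rw [lintegral_prod _ (by fun_prop)]
      simp [mul_comm]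
    _ = _ := by
      rw [Measure.volumeIoiPow, lintegral_withDensity_eq_lintegral_mul _ (by fun_prop) (by fun_prop)]
      have h2 : finrank ℝ Plane = 2 := by simp
      congr 1
      · rw [Measure.toSphere_apply_univ, h2, EuclideanSpace.volume_ball]
        simp [ENNReal.ofReal_mul, Real.pi_pos.le, one_add_one_eq_two]
      · simp only [h2, Pi.mul_apply, Nat.add_one_sub_one, pow_one]
        exact lintegral_subtype_comap measurableSet_Ioi (fun t => ENNReal.ofReal t * f t)

lemma volume_ball_eq (c : Plane) {R : ℝ} (hR : 0 ≤ R) :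
    volume (ball c R) = ENNReal.ofReal (Real.pi * R ^ 2) := by
  rw [EuclideanSpace.volume_ball, ENNReal.ofReal_mul Real.pi_pos.le, ENNReal.ofReal_pow hR, mul_comm]
  simp [one_add_one_eq_two, Real.pi_pos.le]

lemma volume_ball_inter_ball_single {R t : ℝ} (hR : 0 < R) (ht : 0 ≤ t) :
    volume (ball (0 : Plane) R ∩ ball (EuclideanSpace.single 0 t) R) =
      ∫⁻ y : ℝ, ENNReal.ofReal (2 * √(R ^ 2 - y ^ 2) - t) := by
  have e := (volume_preserving_finTwoArrow ℝ).comp (PiLp.volume_preserving_ofLp (Fin 2))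
  -- Overlap of the two horizontal chords at height `p.2`. Where `R ^ 2 - p.2 ^ 2` is negative, `√`
  -- is `0` and the interval is empty since `t ≥ 0`.
  set S : Set (ℝ × ℝ) := {p | p.1 ∈ Ioo (t - √(R ^ 2 - p.2 ^ 2)) (√(R ^ 2 - p.2 ^ 2))}
  have hS : MeasurableSet S := by
    exact (measurableSet_lt (f := fun p : ℝ × ℝ => t - √(R ^ 2 - p.2 ^ 2)) (g := Prod.fst)
      (by fun_prop) (by fun_prop)).inter (measurableSet_lt (f := Prod.fst)
      (g := fun p : ℝ × ℝ => √(R ^ 2 - p.2 ^ 2)) (by fun_prop) (by fun_prop))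
  have hpre : ball (0 : Plane) R ∩ ball (EuclideanSpace.single 0 t) R =
      (MeasurableEquiv.finTwoArrow ∘ WithLp.ofLp) ⁻¹' S := by
    ext x
    have h1 : x ∈ ball (0 : Plane) R ↔ |x 0| < √(R ^ 2 - x 1 ^ 2) := by
      rw [mem_ball, EuclideanSpace.dist_eq, Real.sqrt_lt' hR, Real.lt_sqrt (abs_nonneg _)]
      simp [lt_sub_iff_add_lt]
    have h2 : x ∈ ball (EuclideanSpace.single 0 t : Plane) R ↔
        |x 0 - t| < √(R ^ 2 - x 1 ^ 2) := by
      rw [mem_ball, EuclideanSpace.dist_eq, Real.sqrt_lt' hR, Real.lt_sqrt (abs_nonneg _)]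
      simp [Real.dist_eq, lt_sub_iff_add_lt]
    rw [mem_inter_iff, h1, h2, abs_lt, abs_lt]
    simp only [S, mem_preimage, Function.comp, mem_ofPred_eq, MeasurableEquiv.finTwoArrow_apply,
      mem_Ioo]
    constructor
    · rintro ⟨⟨_, _⟩, _, _⟩
      constructor <;> linarith
    · rintro ⟨_, _⟩
      refine ⟨⟨?_, ?_⟩, ?_, ?_⟩ <;> linarith
  rw [hpre, e.measure_preimage hS.nullMeasurableSet, Measure.volume_eq_prod,
    Measure.prod_apply_symm hS]
  refine lintegral_congr fun y => ?_
  have : (fun x => (x, y)) ⁻¹' S = Ioo (t - √(R ^ 2 - y ^ 2)) (√(R ^ 2 - y ^ 2)) := rfl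
  rw [this, Real.volume_Ioo]
  ring_nf

/-- The area of the intersection of two disks, computed by slices. -/
lemma volume_ball_inter_ball (c d : Plane) {R : ℝ} (hR : 0 < R) :
    volume (ball c R ∩ ball d R) =
      ∫⁻ y : ℝ, ENNReal.ofReal (2 * √(R ^ 2 - y ^ 2) - ‖d - c‖) := by
  set e : Plane := EuclideanSpace.single 0 ‖d - c‖ with he
  have h1 : volume (ball c R ∩ ball d R) = volume (ball (0 : Plane) R ∩ ball (d - c) R) := by
    rw [← measure_preimage_add volume c]
    congr 1
    ext x
    simp only [mem_inter_iff, mem_preimage, mem_ball, dist_eq_norm]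
    rw [show c + x - c = x - 0 by abel, show c + x - d = x - (d - c) by abel]
  have h2 : volume (ball (0 : Plane) R ∩ ball (d - c) R) = volume (ball (0 : Plane) R ∩ ball e R) := by
    -- As `d - c` and `e` have the same norm, reflecting in the line orthogonal to their difference
    -- exchanges them.
    set ρ := (Submodule.span ℝ {d - c - e})ᗮ.reflection
    have hρ : ρ (d - c) = e := Submodule.reflection_sub (by simp [e])
    rw [← ρ.measurePreserving.measure_preimage
      (s := ball 0 R ∩ ball e R)
      (measurableSet_ball.inter measurableSet_ball).nullMeasurableSet]
    congr 1
    ext x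
    rw [mem_preimage, mem_inter_iff, mem_inter_iff, mem_ball, mem_ball, mem_ball, mem_ball, ← hρ,
      LinearIsometryEquiv.dist_map, dist_zero_right, dist_zero_right, LinearIsometryEquiv.norm_map]
  rw [h1, h2, he, volume_ball_inter_ball_single hR (norm_nonneg _)]

/-- Substitute `x = z + y` and apply Tonelli: the kernel depends on `z` only, and the admissible `y`
fill the disk intersected with its translate by `-z`. -/
lemma interaction_ball_eq_lintegral (α : ℝ) (c : Plane) (R : ℝ) :
    interaction α (ball c R) =
      ∫⁻ z : Plane, ENNReal.ofReal (1 / ‖z‖ ^ α) * volume (ball c R ∩ ball (c - z) R) := by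
  have hmeas : Measurable fun z : Plane => ENNReal.ofReal (1 / ‖z‖ ^ α) := by fun_prop
  have hE : MeasurableSet {p : Plane × Plane | p.1 ∈ ball c R ∧ p.2 + p.1 ∈ ball c R} :=
    (measurableSet_ball.preimage measurable_fst).inter
      (measurableSet_ball.preimage (measurable_snd.add measurable_fst))
  calc
    interaction α (ball c R) = ∫⁻ y, ∫⁻ z : Plane,
        {p : Plane × Plane | p.1 ∈ ball c R ∧ p.2 + p.1 ∈ ball c R}.indicator
          (fun p => ENNReal.ofReal (1 / ‖p.2‖ ^ α)) (y, z) := by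
      rw [interaction, ← lintegral_indicator measurableSet_ball]
      refine lintegral_congr fun y => ?_
      by_cases hy : y ∈ ball c R
      · rw [indicator_of_mem hy, ← lintegral_indicator measurableSet_ball,
          ← lintegral_add_right_eq_self _ y]
        refine lintegral_congr fun z => ?_
        by_cases hz : z + y ∈ ball c R
        · rw [indicator_of_mem hz, indicator_of_mem (by exact ⟨hy, hz⟩), add_sub_cancel_right]
        · rw [indicator_of_notMem hz, indicator_of_notMem (fun h => hz h.2)]
      · rw [indicator_of_notMem hy]
        symm
        convert lintegral_zero with z
        exact indicator_of_notMem (fun h => hy h.1) _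
    _ = ∫⁻ z : Plane, ∫⁻ y, {p : Plane × Plane | p.1 ∈ ball c R ∧ p.2 + p.1 ∈ ball c R}.indicator
          (fun p => ENNReal.ofReal (1 / ‖p.2‖ ^ α)) (y, z) :=
      lintegral_lintegral_swap
        ((hmeas.comp measurable_snd).indicator hE).aemeasurable
    _ = _ := by
      refine lintegral_congr fun z => ?_
      have hS : ball c R ∩ ball (c - z) R = {y | y ∈ ball c R ∧ z + y ∈ ball c R} := by
        ext y
        simp only [mem_inter_iff, mem_ball, dist_eq_norm, mem_ofPred_eq]
        rw [show y - (c - z) = z + y - c by abel]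
      rw [hS, ← lintegral_indicator_const (hS ▸ measurableSet_ball.inter measurableSet_ball)]
      rfl

/-- The value of the interaction energy of the unit disk. -/
def diskConstant (α : ℝ) : ℝ :=
  2 * Real.pi ^ 2 * Real.Gamma (2 - α) / (Real.Gamma (2 - α / 2) * Real.Gamma (3 - α / 2))

lemma diskConstant_pos {α : ℝ} (hα1 : α ≤ 1) : 0 < diskConstant α := by
  have h1 := Real.Gamma_pos_of_pos (show 0 < 2 - α by linarith)
  have h2 := Real.Gamma_pos_of_pos (show 0 < 2 - α / 2 by linarith)
  have h3 := Real.Gamma_pos_of_pos (show 0 < 3 - α / 2 by linarith)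
  have := Real.pi_pos
  unfold diskConstant
  positivity

lemma lintegral_Ioi_rpow_mul_sub {α l : ℝ} (hα1 : α ≤ 1) (hl : 0 ≤ l) :
    ∫⁻ t in Ioi (0 : ℝ), ENNReal.ofReal t * (ENNReal.ofReal (1 / t ^ α) * ENNReal.ofReal (l - t)) =
      ENNReal.ofReal (l ^ (3 - α) / ((2 - α) * (3 - α))) := by
  have hint : ∀ r : ℝ, 0 ≤ r → IntervalIntegrable (fun t : ℝ => t ^ r) volume 0 l := fun r hr =>
    intervalIntegral.intervalIntegrable_rpow (Or.inl hr)
  have hF : IntervalIntegrable (fun t : ℝ => l * t ^ (1 - α) - t ^ (2 - α)) volume 0 l :=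
    ((hint _ (by linarith)).const_mul l).sub (hint _ (by linarith))
  have hval : ∫ t in 0..l, (l * t ^ (1 - α) - t ^ (2 - α)) =
      l ^ (3 - α) / ((2 - α) * (3 - α)) := by
    rw [intervalIntegral.integral_sub ((hint _ (by linarith)).const_mul l) (hint _ (by linarith)),
      intervalIntegral.integral_const_mul, integral_rpow (Or.inl (by linarith)),
      integral_rpow (Or.inl (by linarith)), Real.zero_rpow (by linarith),
      Real.zero_rpow (by linarith), show 1 - α + 1 = 2 - α by ring, show 2 - α + 1 = 3 - α by ring]
    have h : l * l ^ (2 - α) = l ^ (3 - α) := by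
      rw [show 3 - α = 1 + (2 - α) by ring, Real.rpow_add_of_nonneg hl (by linarith) (by linarith),
        Real.rpow_one]
    have h2 : 2 - α ≠ 0 := by linarith
    have h3 : 3 - α ≠ 0 := by linarith
    rw [sub_zero, sub_zero, ← mul_div_assoc, h]
    field_simp
    ring
  have hpow : ∀ t : ℝ, 0 < t → t * (1 / t ^ α * (l - t)) = l * t ^ (1 - α) - t ^ (2 - α) := by
    intro t ht
    rw [Real.rpow_sub ht, Real.rpow_sub ht, Real.rpow_one, Real.rpow_two]
    have := (Real.rpow_pos_of_pos ht α).ne'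
    field_simp
  calc
    _ = ∫⁻ t in Ioc 0 l,
          ENNReal.ofReal t * (ENNReal.ofReal (1 / t ^ α) * ENNReal.ofReal (l - t)) := by
      rw [← lintegral_indicator measurableSet_Ioi, ← lintegral_indicator measurableSet_Ioc]
      refine lintegral_congr fun t => ?_
      by_cases h0 : 0 < t
      · by_cases hl' : t ≤ l
        · rw [indicator_of_mem (mem_Ioi.2 h0), indicator_of_mem (mem_Ioc.2 ⟨h0, hl'⟩)]
        · rw [indicator_of_mem (mem_Ioi.2 h0), indicator_of_notMem (fun h => hl' h.2),
            ENNReal.ofReal_of_nonpos (p := l - t) (by linarith), mul_zero, mul_zero]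
      · rw [indicator_of_notMem (s := Ioi 0) (fun h => h0 h),
          indicator_of_notMem (s := Ioc 0 l) (fun h => h0 h.1)]
    _ = ∫⁻ t in Ioc 0 l, ENNReal.ofReal (l * t ^ (1 - α) - t ^ (2 - α)) := by
      refine setLIntegral_congr_fun measurableSet_Ioc fun t ht => ?_
      have : 0 < t ^ α := Real.rpow_pos_of_pos ht.1 α
      rw [← hpow t ht.1, ENNReal.ofReal_mul ht.1.le, ENNReal.ofReal_mul (by positivity)]
    _ = _ := by
      rw [← hval, intervalIntegral.integral_of_le hl, ofReal_integral_eq_lintegral_ofReal]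
      · exact (intervalIntegrable_iff_integrableOn_Ioc_of_le hl).1 hF
      · filter_upwards [ae_restrict_mem measurableSet_Ioc] with t ht
        have : 0 < t ^ α := Real.rpow_pos_of_pos ht.1 α
        rw [← hpow t ht.1]
        have := ht.1
        have := sub_nonneg.2 ht.2
        simp only [Pi.zero_apply]
        positivity

lemma lintegral_sqrt_rpow {q R : ℝ} (hq : 0 < q) (hR : 0 < R) :
    ∫⁻ y : ℝ, ENNReal.ofReal ((2 * √(R ^ 2 - y ^ 2)) ^ q) =
      ENNReal.ofReal (2 * R * (4 * R) ^ q * ProbabilityTheory.beta (q / 2 + 1) (q / 2 + 1)) := by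
  have hb : 0 < ProbabilityTheory.beta (q / 2 + 1) (q / 2 + 1) :=
    ProbabilityTheory.beta_pos (by linarith) (by linarith)
  -- The substitution `y = 2 * R * u - R` turns `R ^ 2 - y ^ 2` into `(2 * R) ^ 2 * (u * (1 - u))`,
  -- so the integrand becomes a multiple of a symmetric beta density.
  rw [← lintegral_sub_right_eq_self _ R, ← Real.smul_map_volume_mul_left (a := 2 * R) (by positivity),
    lintegral_smul_measure, lintegral_map (by fun_prop) (by fun_prop), abs_of_pos (by positivity),
    mul_assoc, ENNReal.ofReal_mul (p := 2 * R) (by positivity), smul_eq_mul]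
  congr 1
  calc
    _ = ∫⁻ u : ℝ, ENNReal.ofReal ((4 * R) ^ q * ProbabilityTheory.beta (q / 2 + 1) (q / 2 + 1)) *
          ProbabilityTheory.betaPDF (q / 2 + 1) (q / 2 + 1) u := by
      refine lintegral_congr fun u => ?_
      by_cases hu : 0 < u ∧ u < 1
      · have hu0 := hu.1
        have hu1 : 0 < 1 - u := by linarith [hu.2]
        rw [ProbabilityTheory.betaPDF_of_pos_lt_one hu.1 hu.2, ← ENNReal.ofReal_mul (by positivity)]
        congr 1
        have : 2 * √(R ^ 2 - (2 * R * u - R) ^ 2) = (4 * R) * √(u * (1 - u)) := by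
          rw [show R ^ 2 - (2 * R * u - R) ^ 2 = (2 * R) ^ 2 * (u * (1 - u)) by ring,
            Real.sqrt_mul (by positivity), Real.sqrt_sq (by positivity)]
          ring
        rw [this, Real.mul_rpow (by positivity) (by positivity), Real.sqrt_eq_rpow,
          ← Real.rpow_mul (by positivity), Real.mul_rpow hu0.le hu1.le]
        rw [add_sub_cancel_right, show 1 / 2 * q = q / 2 by ring]
        generalize ProbabilityTheory.beta (q / 2 + 1) (q / 2 + 1) = b at hb
        field_simp
      · have h0 : R ^ 2 - (2 * R * u - R) ^ 2 ≤ 0 := by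
          rw [show R ^ 2 - (2 * R * u - R) ^ 2 = (2 * R) ^ 2 * (u * (1 - u)) by ring]
          apply mul_nonpos_of_nonneg_of_nonpos (by positivity)
          rw [not_and_or, not_lt, not_lt] at hu
          rcases hu with hu | hu <;> nlinarith
        rw [Real.sqrt_eq_zero_of_nonpos h0, mul_zero, Real.zero_rpow hq.ne',
          ProbabilityTheory.betaPDF_eq, if_neg hu]
        simp
    _ = _ := by
      have hm : Measurable (ProbabilityTheory.betaPDF (q / 2 + 1) (q / 2 + 1)) :=
        (ProbabilityTheory.measurable_betaPDFReal _ _).ennreal_ofReal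
      rw [lintegral_const_mul _ hm, ProbabilityTheory.lintegral_betaPDF_eq_one (by linarith)
        (by linarith), mul_one]

/-- With `s = (3 - α) / 2 + 1`, the beta value is `Γ(s) ^ 2 / Γ(2 * s)`. Legendre duplication at `s`
rewrites `Γ(s) / Γ(2 * s)`; duplication at `s - 1` with the recurrence rewrites the other `Γ(s)`.
The powers of two cancel. -/
lemma diskConstant_eq_beta {α R : ℝ} (hα1 : α ≤ 1) (hR : 0 < R) :
    2 * Real.pi * ((2 * R * (4 * R) ^ (3 - α) *
      ProbabilityTheory.beta ((3 - α) / 2 + 1) ((3 - α) / 2 + 1)) / ((2 - α) * (3 - α))) =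
      diskConstant α * R ^ (4 - α) := by
  have g1 := Real.Gamma_mul_Gamma_add_half ((3 - α) / 2 + 1)
  have g2 := Real.Gamma_mul_Gamma_add_half ((3 - α) / 2)
  have g3 := Real.Gamma_add_one (s := 2 - α) (by linarith)
  have g4 := Real.Gamma_add_one (s := (3 - α) / 2) (by linarith)
  have p1 := Real.Gamma_pos_of_pos (show 0 < 2 - α / 2 by linarith)
  have p2 := Real.Gamma_pos_of_pos (show 0 < 3 - α / 2 by linarith)
  have p3 := Real.Gamma_pos_of_pos (show 0 < 5 - α by linarith)
  rw [show (3 - α) / 2 + 1 + 1 / 2 = 3 - α / 2 by ring,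
    show 2 * ((3 - α) / 2 + 1) = 5 - α by ring, show 1 - (5 - α) = α - 4 by ring] at g1
  rw [show (3 - α) / 2 + 1 / 2 = 2 - α / 2 by ring, show 2 * ((3 - α) / 2) = 2 - α + 1 by ring, g3,
    show 1 - (2 - α + 1) = α - 2 by ring] at g2
  have e1 : (2 : ℝ) ^ (α - 4) * 2 ^ (α - 2) * 4 ^ (3 - α) = 1 := by
    have h4 : (4 : ℝ) ^ (3 - α) = 2 ^ (2 * (3 - α)) := by
      rw [Real.rpow_mul (by norm_num)]
      norm_num
    rw [h4, ← Real.rpow_add (by norm_num), ← Real.rpow_add (by norm_num),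
      show α - 4 + (α - 2) + 2 * (3 - α) = 0 by ring, Real.rpow_zero]
  have e2 : √Real.pi * √Real.pi = Real.pi := Real.mul_self_sqrt Real.pi_pos.le
  have e3 : R ^ (4 - α) = R * R ^ (3 - α) := by
    rw [show 4 - α = 1 + (3 - α) by ring, Real.rpow_add hR, Real.rpow_one]
  have h2 : 2 - α ≠ 0 := by linarith
  have h3 : 3 - α ≠ 0 := by linarith
  have G1 : Real.Gamma ((3 - α) / 2 + 1) / Real.Gamma (5 - α) =
      2 ^ (α - 4) * √Real.pi / Real.Gamma (3 - α / 2) := by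
    rw [div_eq_div_iff p3.ne' p2.ne', g1]
    ring
  have G2 : Real.Gamma ((3 - α) / 2 + 1) =
      (3 - α) / 2 * ((2 - α) * Real.Gamma (2 - α) * 2 ^ (α - 2) * √Real.pi) /
        Real.Gamma (2 - α / 2) := by
    rw [eq_div_iff p1.ne', g4, mul_assoc, g2]
  have hbeta : ProbabilityTheory.beta ((3 - α) / 2 + 1) ((3 - α) / 2 + 1) =
      (2 ^ (α - 4) * √Real.pi / Real.Gamma (3 - α / 2)) *
      ((3 - α) / 2 * ((2 - α) * Real.Gamma (2 - α) * 2 ^ (α - 2) * √Real.pi) /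
        Real.Gamma (2 - α / 2)) := by
    rw [← G2, ← G1, ProbabilityTheory.beta,
      show (3 - α) / 2 + 1 + ((3 - α) / 2 + 1) = 5 - α by ring]
    ring
  rw [hbeta, Real.mul_rpow (by norm_num) hR.le, e3, diskConstant]
  calc
    _ = 2 * Real.pi * (√Real.pi * √Real.pi) * (2 ^ (α - 4) * 2 ^ (α - 2) * 4 ^ (3 - α)) *
        Real.Gamma (2 - α) / (Real.Gamma (2 - α / 2) * Real.Gamma (3 - α / 2)) *
          (R * R ^ (3 - α)) := by
      field_simp
    _ = _ := by
      rw [e1, e2]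
      ring

/-- The interaction energy of a disk. -/
lemma interaction_ball {α : ℝ} (hα1 : α ≤ 1) (c : Plane) {R : ℝ} (hR : 0 < R) :
    interaction α (ball c R) = ENNReal.ofReal (diskConstant α * R ^ (4 - α)) := by
  have hsqrt : Measurable fun p : ℝ × ℝ => ENNReal.ofReal (2 * √(R ^ 2 - p.2 ^ 2) - p.1) := by
    fun_prop
  have hk : Measurable fun t : ℝ => ENNReal.ofReal (1 / t ^ α) := by fun_prop
  have hα2 : 0 < 2 - α := by linarith
  have hα3 : 0 < 3 - α := by linarith
  calc
    interaction α (ball c R) = ∫⁻ z : Plane, ENNReal.ofReal (1 / ‖z‖ ^ α) *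
        ∫⁻ y : ℝ, ENNReal.ofReal (2 * √(R ^ 2 - y ^ 2) - ‖z‖) := by
      rw [interaction_ball_eq_lintegral]
      refine lintegral_congr fun z => ?_
      rw [volume_ball_inter_ball _ _ hR, sub_sub_cancel_left, norm_neg]
    _ = ENNReal.ofReal (2 * Real.pi) * ∫⁻ t in Ioi (0 : ℝ), ENNReal.ofReal t *
        (ENNReal.ofReal (1 / t ^ α) *
          ∫⁻ y : ℝ, ENNReal.ofReal (2 * √(R ^ 2 - y ^ 2) - t)) :=
      lintegral_fun_norm (f := fun t => ENNReal.ofReal (1 / t ^ α) *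
        ∫⁻ y : ℝ, ENNReal.ofReal (2 * √(R ^ 2 - y ^ 2) - t))
        (hk.mul hsqrt.lintegral_prod_right')
    _ = ENNReal.ofReal (2 * Real.pi) * ∫⁻ t in Ioi (0 : ℝ), ∫⁻ y : ℝ, ENNReal.ofReal t *
        (ENNReal.ofReal (1 / t ^ α) * ENNReal.ofReal (2 * √(R ^ 2 - y ^ 2) - t)) := by
      congr 1
      refine lintegral_congr fun t => ?_
      rw [← lintegral_const_mul _ (by fun_prop), ← lintegral_const_mul _ (by fun_prop)]
    -- Integrating over the distance `t` before the height `y` leaves an elementary power integral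
    -- inside and a beta integral outside.
    _ = ENNReal.ofReal (2 * Real.pi) * ∫⁻ y : ℝ, ∫⁻ t in Ioi (0 : ℝ), ENNReal.ofReal t *
        (ENNReal.ofReal (1 / t ^ α) * ENNReal.ofReal (2 * √(R ^ 2 - y ^ 2) - t)) := by
      congr 1
      exact lintegral_lintegral_swap (by fun_prop)
    _ = ENNReal.ofReal (2 * Real.pi) * ∫⁻ y : ℝ,
        ENNReal.ofReal ((2 * √(R ^ 2 - y ^ 2)) ^ (3 - α)) *
          ENNReal.ofReal (1 / ((2 - α) * (3 - α))) := by
      congr 1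
      refine lintegral_congr fun y => ?_
      rw [lintegral_Ioi_rpow_mul_sub hα1 (by positivity), ← ENNReal.ofReal_mul (by positivity),
        mul_one_div]
    _ = _ := by
      rw [lintegral_mul_const _ (by fun_prop), lintegral_sqrt_rpow hα3 hR,
        ← ENNReal.ofReal_mul' (by positivity), ← ENNReal.ofReal_mul (by positivity), mul_one_div,
        diskConstant_eq_beta hα1 hR]

lemma unitDiskInteraction_eq {α : ℝ} (hα1 : α ≤ 1) : unitDiskInteraction α = diskConstant α := by
  rw [unitDiskInteraction, interaction_ball hα1 _ one_pos, Real.one_rpow, mul_one,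
    ENNReal.toReal_ofReal (diskConstant_pos hα1).le]

/-! ### Perimeter of a disk -/

namespace IsTestField

variable {φ : Plane → Plane}

lemma contDiff_coord (hφ : IsTestField φ) (i : Fin 2) : ContDiff ℝ 1 fun x => φ x i :=
  (contDiff_euclidean.1 hφ.1) i

lemma hasCompactSupport_coord (hφ : IsTestField φ) (i : Fin 2) :
    HasCompactSupport fun x => φ x i :=
  hφ.2.1.comp_left (g := fun v : Plane => v i) rfl

lemma fderiv_coord (hφ : IsTestField φ) (x v : Plane) (i : Fin 2) :
    fderiv ℝ φ x v i = fderiv ℝ (fun y => φ y i) x v := by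
  have h : HasFDerivAt φ (fderiv ℝ φ x) x := (hφ.1.differentiable one_ne_zero x).hasFDerivAt
  have h2 := ((EuclideanSpace.proj i : Plane →L[ℝ] ℝ).hasFDerivAt.comp x h).fderiv
  have h3 : ((EuclideanSpace.proj i : Plane →L[ℝ] ℝ) ∘ φ) = fun y => φ y i := rfl
  rw [h3] at h2
  rw [h2]
  rfl

lemma continuous_divergence (hφ : IsTestField φ) : Continuous (divergence φ) := by
  have := hφ.1.continuous_fderiv one_ne_zero
  unfold divergence
  fun_prop

lemma hasCompactSupport_divergence (hφ : IsTestField φ) : HasCompactSupport (divergence φ) :=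
  (hφ.2.1.fderiv (𝕜 := ℝ)).comp_left
    (g := fun L : Plane →L[ℝ] Plane => ∑ i : Fin 2, L (EuclideanSpace.single i 1) i) (by simp)

lemma integrable_divergence (hφ : IsTestField φ) : Integrable (divergence φ) :=
  hφ.continuous_divergence.integrable_of_hasCompactSupport hφ.hasCompactSupport_divergence

/-- Integration by parts against a Lipschitz function. -/
lemma integral_divergence_mul (hφ : IsTestField φ) {η : Plane → ℝ} {K : NNReal}
    (hη : LipschitzWith K η) :
    ∫ x, divergence φ x * η x = -∫ x, fderiv ℝ η x (φ x) := by
  have hlip : ∀ i, ∃ D, LipschitzWith D fun x => φ x i := fun i =>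
    (hφ.contDiff_coord i).lipschitzWith_of_hasCompactSupport (hφ.hasCompactSupport_coord i)
      one_ne_zero
  choose D hD using hlip
  have hparts : ∀ i : Fin 2, ∫ x, fderiv ℝ φ x (EuclideanSpace.single i 1) i * η x =
      -∫ x, lineDeriv ℝ η x (EuclideanSpace.single i 1) * φ x i := by
    intro i
    rw [hη.integral_lineDeriv_mul_eq (hD i) (hφ.hasCompactSupport_coord i), ← integral_neg]
    refine integral_congr_ae (Eventually.of_forall fun x => ?_)
    have hd : DifferentiableAt ℝ (fun y => φ y i) x :=
      (hφ.contDiff_coord i).differentiable one_ne_zero x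
    simp only [hφ.fderiv_coord]
    rw [hd.lineDeriv_eq_fderiv, map_neg]
    ring
  have hint1 : ∀ i : Fin 2, Integrable
      fun x => fderiv ℝ φ x (EuclideanSpace.single i 1) i * η x := by
    intro i
    have := hφ.1.continuous_fderiv one_ne_zero
    have := hη.continuous
    refine Continuous.integrable_of_hasCompactSupport (by fun_prop) ?_
    exact HasCompactSupport.mul_right ((hφ.2.1.fderiv (𝕜 := ℝ)).comp_left
      (g := fun L : Plane →L[ℝ] Plane => L (EuclideanSpace.single i 1) i) (by simp))
  have hint2 : ∀ i : Fin 2, Integrable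
      fun x => lineDeriv ℝ η x (EuclideanSpace.single i 1) * φ x i := by
    intro i
    have h : Integrable fun x => φ x i :=
      (hφ.contDiff_coord i).continuous.integrable_of_hasCompactSupport (hφ.hasCompactSupport_coord i)
    exact h.bdd_mul (aestronglyMeasurable_lineDeriv hη.continuous _)
      (Eventually.of_forall fun x => norm_lineDeriv_le_of_lipschitz ℝ hη)
  simp only [divergence, Finset.sum_mul]
  rw [integral_finsetSum _ fun i _ => hint1 i, Finset.sum_congr rfl fun i _ => hparts i,
    Finset.sum_neg_distrib, ← integral_finsetSum _ fun i _ => hint2 i]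
  congr 1
  refine integral_congr_ae ?_
  -- By Rademacher's theorem the line derivatives assemble into a linear map almost everywhere.
  filter_upwards [hη.ae_differentiableAt] with x hx
  have hsum : φ x = ∑ i : Fin 2, φ x i • EuclideanSpace.single i (1 : ℝ) := by
    ext j
    fin_cases j <;> simp
  conv_rhs => rw [hsum, map_sum]
  refine Finset.sum_congr rfl fun i _ => ?_
  rw [hx.lineDeriv_eq_fderiv, map_smul, smul_eq_mul, mul_comm]

end IsTestField

/-- The radial function equal to `1` on the disk of radius `R - ε`, to `0` outside the disk of
radius `R`, and affine in the distance to the centre in between. -/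
def radialCutoff (c : Plane) (R ε : ℝ) (x : Plane) : ℝ :=
  max 0 (min 1 ((R - dist x c) / ε))

lemma lipschitzWith_radialCutoff (c : Plane) (R : ℝ) {ε : ℝ} (hε : 0 < ε) :
    LipschitzWith (Real.toNNReal (1 / ε)) (radialCutoff c R ε) := by
  refine LipschitzWith.const_max (LipschitzWith.const_min ?_ 1) 0
  refine LipschitzWith.of_dist_le_mul fun x y => ?_
  rw [Real.coe_toNNReal _ (by positivity), Real.dist_eq, ← sub_div, abs_div, abs_of_pos hε,
    one_div_mul_eq_div, sub_sub_sub_cancel_left, abs_sub_comm]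
  gcongr
  exact abs_dist_sub_le x y c

lemma fderiv_radialCutoff_of_lt {c : Plane} {R ε : ℝ} (hε : 0 < ε) {x : Plane}
    (hx : dist x c < R - ε) : fderiv ℝ (radialCutoff c R ε) x = 0 := by
  have : radialCutoff c R ε =ᶠ[𝓝 x] fun _ => 1 := by
    filter_upwards [(isOpen_ball (x := c) (ε := R - ε)).mem_nhds hx] with y hy
    have hy : dist y c < R - ε := hy
    have : 1 ≤ (R - dist y c) / ε := by
      rw [le_div_iff₀ hε]
      linarith
    rw [radialCutoff, min_eq_left this, max_eq_right zero_le_one]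
  rw [this.fderiv_eq, fderiv_fun_const]
  rfl

lemma radialCutoff_of_le {c : Plane} {R ε : ℝ} (hε : 0 < ε) {x : Plane} (hx : R ≤ dist x c) :
    radialCutoff c R ε x = 0 :=
  max_eq_left ((min_le_right _ _).trans (div_nonpos_of_nonpos_of_nonneg (by linarith) hε.le))

lemma fderiv_radialCutoff_of_gt {c : Plane} {R ε : ℝ} (hε : 0 < ε) {x : Plane}
    (hx : R < dist x c) : fderiv ℝ (radialCutoff c R ε) x = 0 := by
  have : radialCutoff c R ε =ᶠ[𝓝 x] fun _ => 0 := by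
    have ho : IsOpen {y : Plane | R < dist y c} := isOpen_lt (by fun_prop) (by fun_prop)
    filter_upwards [ho.mem_nhds hx] with y hy
    exact radialCutoff_of_le hε (le_of_lt hy)
  rw [this.fderiv_eq, fderiv_fun_const]
  rfl

/-- After integration by parts, the gradient of the cutoff has norm at most `1 / ε` and lives on an
annulus of area `π * (2 * R * ε - ε ^ 2)`, which gives `2 * π * R - π * ε`. -/
lemma integral_divergence_mul_radialCutoff_le {φ : Plane → Plane} (hφ : IsTestField φ) (c : Plane)
    {R ε : ℝ} (hε : 0 < ε) (hεR : ε < R) :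
    ∫ x, divergence φ x * radialCutoff c R ε x ≤ 2 * Real.pi * R := by
  have hlip := lipschitzWith_radialCutoff c R hε
  rw [hφ.integral_divergence_mul hlip]
  refine (neg_le_abs _).trans ?_
  set A := closedBall c R \ ball c (R - ε)
  have hA : MeasurableSet A := measurableSet_closedBall.diff measurableSet_ball
  have hAvol : volume.real A = Real.pi * R ^ 2 - Real.pi * (R - ε) ^ 2 := by
    have hR : 0 < R := hε.trans hεR
    have h1 : volume.real (closedBall c R) = Real.pi * R ^ 2 := by
      rw [measureReal_def, Measure.addHaar_closedBall_eq_addHaar_ball, volume_ball_eq _ hR.le,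
        ENNReal.toReal_ofReal (by positivity)]
    have h2 : volume.real (ball c (R - ε)) = Real.pi * (R - ε) ^ 2 := by
      rw [measureReal_def, volume_ball_eq _ (by linarith),
        ENNReal.toReal_ofReal (by positivity)]
    rw [measureReal_sdiff (ball_subset_closedBall.trans (closedBall_subset_closedBall (by linarith)))
      measurableSet_ball measure_closedBall_lt_top.ne, h1, h2]
  have hAfin : volume A ≠ ∞ := ((measure_mono sdiff_subset).trans_lt measure_closedBall_lt_top).ne
  have key := norm_integral_le_of_norm_le (f := fun x => fderiv ℝ (radialCutoff c R ε) x (φ x))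
    (g := A.indicator fun _ => 1 / ε) (μ := volume)
    ((integrable_indicator_iff hA).2 (integrableOn_const hAfin)) (Eventually.of_forall fun x => ?_)
  · rw [integral_indicator_const _ hA, hAvol, Real.norm_eq_abs] at key
    refine key.trans ?_
    have : (Real.pi * R ^ 2 - Real.pi * (R - ε) ^ 2) • (1 / ε) = 2 * Real.pi * R - Real.pi * ε := by
      rw [smul_eq_mul]
      field_simp
      ring
    rw [this]
    have := Real.pi_pos
    nlinarith
  · by_cases hx : x ∈ A
    · rw [indicator_of_mem hx]
      have h := norm_fderiv_le_of_lipschitz ℝ (x₀ := x) hlip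
      rw [Real.coe_toNNReal _ (by positivity)] at h
      calc _ ≤ ‖fderiv ℝ (radialCutoff c R ε) x‖ * ‖φ x‖ := ContinuousLinearMap.le_opNorm _ _
        _ ≤ 1 / ε * 1 := by
          gcongr
          exact hφ.2.2 x
        _ = _ := mul_one _
    · rw [indicator_of_notMem hx]
      have : fderiv ℝ (radialCutoff c R ε) x = 0 := by
        by_contra h
        refine hx ⟨?_, fun h' => h (fderiv_radialCutoff_of_lt hε h')⟩
        rw [mem_closedBall]
        by_contra! h'
        exact h (fderiv_radialCutoff_of_gt hε h')
      simp [this]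

/-- The cutoffs tend pointwise to the indicator of the open disk as `ε` decreases to `0`; dominated
convergence passes the bound to the limit. -/
lemma setIntegral_ball_divergence_le {φ : Plane → Plane} (hφ : IsTestField φ) (c : Plane)
    {R : ℝ} (hR : 0 < R) : ∫ x in ball c R, divergence φ x ≤ 2 * Real.pi * R := by
  rw [← integral_indicator measurableSet_ball]
  have hlim : Tendsto (fun ε : ℝ => ∫ x, divergence φ x * radialCutoff c R ε x) (𝓝[>] 0)
      (𝓝 (∫ x, (ball c R).indicator (divergence φ) x)) := by
    refine tendsto_integral_filter_of_dominated_convergence (fun x => ‖divergence φ x‖) ?_ ?_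
      hφ.integrable_divergence.norm ?_
    · filter_upwards [self_mem_nhdsWithin] with ε hε
      exact (hφ.continuous_divergence.mul
        (lipschitzWith_radialCutoff c R hε).continuous).aestronglyMeasurable
    · refine Eventually.of_forall fun ε => Eventually.of_forall fun x => ?_
      rw [norm_mul]
      refine mul_le_of_le_one_right (norm_nonneg _) ?_
      rw [Real.norm_eq_abs, abs_of_nonneg (le_max_left _ _)]
      exact max_le zero_le_one (min_le_left _ _)
    · refine Eventually.of_forall fun x => ?_
      refine tendsto_const_nhds.congr' ?_
      by_cases hx : x ∈ ball c R
      · have hx' : 0 < R - dist x c := sub_pos.2 hx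
        filter_upwards [Ioo_mem_nhdsGT hx'] with ε hε
        have : 1 ≤ (R - dist x c) / ε := by
          rw [le_div_iff₀ hε.1]
          linarith [hε.2]
        rw [indicator_of_mem hx, radialCutoff, min_eq_left this, max_eq_right zero_le_one, mul_one]
      · filter_upwards [self_mem_nhdsWithin] with ε hε
        rw [indicator_of_notMem hx, radialCutoff_of_le hε (not_lt.1 hx), mul_zero]
  refine le_of_tendsto hlim ?_
  filter_upwards [Ioo_mem_nhdsGT hR] with ε hε
  exact integral_divergence_mul_radialCutoff_le hφ c hε.1 hε.2

lemma perimeter_ball_le (c : Plane) {R : ℝ} (hR : 0 < R) :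
    perimeter (ball c R) ≤ ENNReal.ofReal (2 * Real.pi * R) :=
  iSup₂_le fun _ hφ => ENNReal.ofReal_le_ofReal (setIntegral_ball_divergence_le hφ c hR)

/-- The field `x / (R + ε)`, damped by a bump equal to `1` on the disk and vanishing beyond radius
`R + ε`, is admissible and has constant divergence on the disk. -/
lemma le_perimeter_ball {R ε : ℝ} (hR : 0 < R) (hε : 0 < ε) :
    ENNReal.ofReal (2 / (R + ε) * (Real.pi * R ^ 2)) ≤ perimeter (ball (0 : Plane) R) := by
  let b : ContDiffBump (0 : Plane) := ⟨R, R + ε, hR, by linarith⟩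
  set φ : Plane → Plane := fun x => b x • ((R + ε)⁻¹ • x) with hφdef
  have hφ : IsTestField φ := by
    refine ⟨b.contDiff.smul (by fun_prop), b.hasCompactSupport.smul_right, fun x => ?_⟩
    rw [hφdef, norm_smul, norm_smul, Real.norm_eq_abs, abs_of_nonneg b.nonneg, norm_inv,
      Real.norm_eq_abs, abs_of_pos (by positivity)]
    by_cases hx : dist x 0 < R + ε
    · rw [dist_zero_right] at hx
      refine mul_le_one₀ b.le_one (by positivity) ?_
      rw [inv_mul_le_one₀ (by positivity)]
      exact hx.le
    · rw [b.zero_of_le_dist (not_lt.1 hx), zero_mul]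
      exact zero_le_one
  have hdiv : ∀ x ∈ ball (0 : Plane) R, divergence φ x = 2 / (R + ε) := by
    intro x hx
    have h : φ =ᶠ[𝓝 x] fun y => (R + ε)⁻¹ • y := by
      filter_upwards [isOpen_ball.mem_nhds hx] with y hy
      rw [hφdef]
      dsimp only
      rw [b.one_of_mem_closedBall (ball_subset_closedBall hy), one_smul]
    have h2 : HasFDerivAt (fun y : Plane => (R + ε)⁻¹ • y)
        ((R + ε)⁻¹ • ContinuousLinearMap.id ℝ Plane) x := (hasFDerivAt_id (𝕜 := ℝ) x).fun_const_smul (R + ε)⁻¹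
    rw [divergence, h.fderiv_eq, h2.fderiv]
    simp [div_eq_mul_inv]
  refine le_trans (ENNReal.ofReal_le_ofReal (le_of_eq ?_)) (le_iSup₂ (α := ℝ≥0∞) φ hφ)
  rw [setIntegral_congr_fun measurableSet_ball hdiv, setIntegral_const, measureReal_def,
    volume_ball_eq _ hR.le, ENNReal.toReal_ofReal (by have := Real.pi_pos; positivity),
    smul_eq_mul, mul_comm]

lemma perimeter_ball {R : ℝ} (hR : 0 < R) :
    perimeter (ball (0 : Plane) R) = ENNReal.ofReal (2 * Real.pi * R) := by
  refine le_antisymm (perimeter_ball_le 0 hR) ?_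
  have hlim : Tendsto (fun ε : ℝ => ENNReal.ofReal (2 / (R + ε) * (Real.pi * R ^ 2))) (𝓝[>] 0)
      (𝓝 (ENNReal.ofReal (2 / (R + 0) * (Real.pi * R ^ 2)))) := by
    refine ENNReal.tendsto_ofReal (Tendsto.mul_const _ ?_)
    refine tendsto_nhdsWithin_of_tendsto_nhds (Tendsto.div tendsto_const_nhds ?_ (by simpa using hR.ne'))
    exact tendsto_const_nhds.add tendsto_id
  have heq : 2 / (R + 0) * (Real.pi * R ^ 2) = 2 * Real.pi * R := by
    rw [add_zero]
    field_simp
  rw [heq] at hlim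
  refine le_of_tendsto hlim ?_
  filter_upwards [self_mem_nhdsWithin] with ε hε
  exact le_perimeter_ball hR hε

lemma energy_ball {α : ℝ} (hα1 : α ≤ 1) {R : ℝ} (hR : 0 < R) :
    energy α (ball (0 : Plane) R) = ENNReal.ofReal (diskEnergy α R) := by
  have := Real.pi_pos
  have := (diskConstant_pos hα1).le
  rw [energy, perimeter_ball hR, interaction_ball hα1 0 hR, diskEnergy, unitDiskInteraction_eq hα1,
    ENNReal.ofReal_add (by positivity) (by positivity)]

/-! ### Distant disks as competitors -/

/-- For a fixed field the divergence integral splits over the pieces, and each piece is bounded by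
its own supremum. -/
lemma perimeter_iUnion_le {ι : Type*} [Fintype ι] {s : ι → Set Plane}
    (hs : ∀ i, MeasurableSet (s i)) (hd : Pairwise (Function.onFun Disjoint s)) :
    perimeter (⋃ i, s i) ≤ ∑ i, perimeter (s i) := by
  refine iSup₂_le fun φ hφ => ?_
  rw [integral_iUnion_fintype hs hd fun i => hφ.integrable_divergence.integrableOn]
  calc
    _ ≤ ∑ i, ENNReal.ofReal (∫ x in s i, divergence φ x) :=
      Finset.le_sum_of_subadditive _ ENNReal.ofReal_zero.le (fun _ _ => ENNReal.ofReal_add_le) _ _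
    _ ≤ _ := Finset.sum_le_sum fun i _ => le_iSup₂ (f := fun (φ : Plane → Plane)
      (_ : IsTestField φ) => ENNReal.ofReal (∫ x in s i, divergence φ x)) φ hφ

lemma interaction_iUnion_le {ι : Type*} [Fintype ι] (α : ℝ) (s : ι → Set Plane) :
    interaction α (⋃ i, s i) ≤
      ∑ i, ∑ j, ∫⁻ y in s i, ∫⁻ x in s j, ENNReal.ofReal (1 / ‖x - y‖ ^ α) := by
  have hk : Measurable fun p : Plane × Plane => ENNReal.ofReal (1 / ‖p.2 - p.1‖ ^ α) := by fun_prop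
  calc
    _ ≤ ∑ i, ∫⁻ y in s i, ∫⁻ x in ⋃ j, s j, ENNReal.ofReal (1 / ‖x - y‖ ^ α) := by
      simpa only [tsum_fintype, interaction] using lintegral_iUnion_le (μ := volume) s
        fun y => ∫⁻ x in ⋃ j, s j, ENNReal.ofReal (1 / ‖x - y‖ ^ α)
    _ ≤ _ := by
      refine Finset.sum_le_sum fun i _ => ?_
      rw [← lintegral_finsetSum _ fun j _ => hk.lintegral_prod_right']
      refine lintegral_mono fun y => ?_
      simpa only [tsum_fintype] using lintegral_iUnion_le (μ := volume) s
        fun x => ENNReal.ofReal (1 / ‖x - y‖ ^ α)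

lemma crossInteraction_le {α D : ℝ} (hα : 0 ≤ α) (hD : 0 < D) {A B : Set Plane}
    (hA : MeasurableSet A) (hB : MeasurableSet B) (h : ∀ y ∈ A, ∀ x ∈ B, D ≤ ‖x - y‖) :
    ∫⁻ y in A, ∫⁻ x in B, ENNReal.ofReal (1 / ‖x - y‖ ^ α) ≤
      ENNReal.ofReal (1 / D ^ α) * volume B * volume A := by
  rw [← setLIntegral_const]
  refine setLIntegral_mono' hA fun y hy => ?_
  rw [← setLIntegral_const]
  refine setLIntegral_mono' hB fun x hx => ENNReal.ofReal_le_ofReal ?_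
  gcongr
  exact h y hy x hx

/-- The union of `n` disks of radius `r` with centres on a line, at mutual distance at least `D`. -/
def diskChain (n : ℕ) (r D : ℝ) : Set Plane :=
  ⋃ i : Fin n, ball (EuclideanSpace.single 0 ((i : ℝ) * (D + 2 * r))) r

lemma le_norm_sub_of_mem_diskChain {n : ℕ} {r D : ℝ} (hr : 0 < r) (hD : 0 < D) {i j : Fin n}
    (hij : i ≠ j) {x y : Plane} (hy : y ∈ ball (EuclideanSpace.single 0 ((i : ℝ) * (D + 2 * r))) r)
    (hx : x ∈ ball (EuclideanSpace.single 0 ((j : ℝ) * (D + 2 * r))) r) : D ≤ ‖x - y‖ := by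
  set a : Plane := EuclideanSpace.single 0 ((i : ℝ) * (D + 2 * r))
  set b : Plane := EuclideanSpace.single 0 ((j : ℝ) * (D + 2 * r))
  have hab : D + 2 * r ≤ dist a b := by
    have h1 : (1 : ℝ) ≤ |(i : ℝ) - j| := by
      have : (1 : ℤ) ≤ |(i : ℤ) - j| := by
        apply Int.one_le_abs
        have := Fin.val_ne_of_ne hij
        omega
      exact_mod_cast this
    have h2 : dist a b = |(i : ℝ) - j| * (D + 2 * r) := by
      simp only [a, b]
      rw [PiLp.dist_single_same, Real.dist_eq, ← sub_mul, abs_mul,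
        abs_of_pos (a := D + 2 * r) (by positivity)]
    rw [h2]
    exact le_mul_of_one_le_left (by positivity) h1
  have h3 := dist_triangle4 a y x b
  rw [mem_ball, dist_comm] at hy
  rw [mem_ball] at hx
  rw [← dist_eq_norm, dist_comm]
  linarith

lemma pairwise_disjoint_diskChain {n : ℕ} {r D : ℝ} (hr : 0 < r) (hD : 0 < D) :
    Pairwise (Function.onFun Disjoint fun i : Fin n =>
      ball (EuclideanSpace.single 0 ((i : ℝ) * (D + 2 * r)) : Plane) r) := by
  intro i j hij
  refine Set.disjoint_left.2 fun x hx hx' => ?_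
  have := le_norm_sub_of_mem_diskChain hr hD hij hx hx'
  rw [sub_self, norm_zero] at this
  linarith

lemma measurableSet_diskChain (n : ℕ) (r D : ℝ) : MeasurableSet (diskChain n r D) :=
  MeasurableSet.iUnion fun _ => measurableSet_ball

lemma volume_diskChain (n : ℕ) {r D : ℝ} (hr : 0 < r) (hD : 0 < D) :
    volume (diskChain n r D) = ENNReal.ofReal (n * (Real.pi * r ^ 2)) := by
  rw [diskChain, measure_iUnion (pairwise_disjoint_diskChain hr hD) fun _ => measurableSet_ball,
    tsum_fintype]
  simp only [volume_ball_eq _ hr.le, Finset.sum_const, Finset.card_univ, Fintype.card_fin,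
    nsmul_eq_mul]
  rw [ENNReal.ofReal_mul (Nat.cast_nonneg n), ENNReal.ofReal_natCast]

lemma energy_diskChain_le {α : ℝ} (hα : 0 ≤ α) (hα1 : α ≤ 1) (n : ℕ) {r D : ℝ} (hr : 0 < r)
    (hD : 0 < D) :
    energy α (diskChain n r D) ≤ ENNReal.ofReal (n * diskEnergy α r) +
      ENNReal.ofReal (1 / D ^ α) * (n * n * ENNReal.ofReal (Real.pi * r ^ 2) ^ 2) := by
  have hπ := Real.pi_pos
  have hV := (diskConstant_pos hα1).le
  set C := ENNReal.ofReal (1 / D ^ α) * ENNReal.ofReal (Real.pi * r ^ 2) ^ 2 with hC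
  have hper : perimeter (diskChain n r D) ≤ n * ENNReal.ofReal (2 * Real.pi * r) := by
    refine (perimeter_iUnion_le (fun _ => measurableSet_ball)
      (pairwise_disjoint_diskChain hr hD)).trans ?_
    refine (Finset.sum_le_card_nsmul _ _ _ fun i _ => perimeter_ball_le _ hr).trans ?_
    simp
  have hint : interaction α (diskChain n r D) ≤
      n * (ENNReal.ofReal (diskConstant α * r ^ (4 - α)) + n * C) := by
    refine (interaction_iUnion_le α _).trans ?_
    have hrow : ∀ i : Fin n, ∑ j : Fin n,
        ∫⁻ y in ball (EuclideanSpace.single 0 ((i : ℝ) * (D + 2 * r)) : Plane) r,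
          ∫⁻ x in ball (EuclideanSpace.single 0 ((j : ℝ) * (D + 2 * r)) : Plane) r,
            ENNReal.ofReal (1 / ‖x - y‖ ^ α) ≤
        ENNReal.ofReal (diskConstant α * r ^ (4 - α)) + n * C := by
      intro i
      calc
        -- The cross bound `C` is added on the diagonal too; this slack makes every row bound the
        -- same and still vanishes for large `D`.
        _ ≤ ∑ j : Fin n, ((if j = i then ENNReal.ofReal (diskConstant α * r ^ (4 - α)) else 0) + C) := by
          refine Finset.sum_le_sum fun j _ => ?_
          by_cases hij : j = i
          · subst hij
            rw [if_pos rfl]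
            exact (interaction_ball hα1 _ hr).le.trans le_self_add
          · rw [if_neg hij, zero_add]
            refine (crossInteraction_le hα hD measurableSet_ball measurableSet_ball
              fun y hy x hx => le_norm_sub_of_mem_diskChain hr hD (Ne.symm hij) hy hx).trans ?_
            rw [volume_ball_eq _ hr.le, volume_ball_eq _ hr.le, hC, mul_assoc, ← sq]
        _ = _ := by
          rw [Finset.sum_add_distrib, Finset.sum_ite_eq' Finset.univ i]
          simp
    refine (Finset.sum_le_card_nsmul _ _ _ fun i _ => hrow i).trans (le_of_eq ?_)
    rw [Finset.card_univ, Fintype.card_fin, nsmul_eq_mul]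
  refine (add_le_add hper hint).trans (le_of_eq ?_)
  rw [diskEnergy, unitDiskInteraction_eq hα1, ENNReal.ofReal_mul (Nat.cast_nonneg n),
    ENNReal.ofReal_natCast, ENNReal.ofReal_add (by positivity) (by positivity), hC]
  ring

/-- The chain has mass `m` for every gap `D > 0`, so the gap can be sent to infinity with `n` and
`r` fixed. -/
lemma energy_le_of_isMinimizer {α m : ℝ} (hα : 0 < α) (hα1 : α ≤ 1) {Ω : Set Plane}
    (hΩ : IsMinimizer α m Ω) (n : ℕ) {r : ℝ} (hr : 0 < r) (hm : n * (Real.pi * r ^ 2) = m) :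
    energy α Ω ≤ ENNReal.ofReal (n * diskEnergy α r) := by
  set K : ℝ≥0∞ := n * n * ENNReal.ofReal (Real.pi * r ^ 2) ^ 2
  have hK : K ≠ ∞ := by finiteness
  have hlim : Tendsto (fun D : ℝ => ENNReal.ofReal (n * diskEnergy α r) +
      ENNReal.ofReal (1 / D ^ α) * K) atTop (𝓝 (ENNReal.ofReal (n * diskEnergy α r) + 0 * K)) := by
    refine Tendsto.add tendsto_const_nhds (ENNReal.Tendsto.mul_const ?_ (Or.inr hK))
    rw [← ENNReal.ofReal_zero]
    refine ENNReal.tendsto_ofReal ?_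
    simp only [one_div]
    exact (tendsto_rpow_atTop hα).inv_tendsto_atTop
  rw [zero_mul, add_zero] at hlim
  refine ge_of_tendsto hlim ?_
  filter_upwards [eventually_gt_atTop 0] with D hD
  refine (hΩ.minimal _ (measurableSet_diskChain n r D).nullMeasurableSet ?_).trans
    (energy_diskChain_le hα.le hα1 n hr hD)
  rw [volume_diskChain n hr hD, hm]

/-! ### Energy density of a disk and the critical radius -/

/-- The energy of a disk per unit of mass is a quasiconvex function of the radius. -/
lemma diskEnergy_div_le_max {α : ℝ} (hα1 : α ≤ 1) {a b r : ℝ} (ha : 0 < a) (har : a ≤ r)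
    (hrb : r ≤ b) :
    diskEnergy α r / (Real.pi * r ^ 2) ≤
      max (diskEnergy α a / (Real.pi * a ^ 2)) (diskEnergy α b / (Real.pi * b ^ 2)) := by
  have hV := (diskConstant_pos hα1).le
  have hπ := Real.pi_pos
  -- The density in the variable `s = log t`, where convexity is visible; in `t` itself only
  -- quasiconvexity is needed.
  set g : ℝ → ℝ := fun s => 2 * Real.exp (-s) + diskConstant α / Real.pi * Real.exp ((2 - α) * s)
  have hg : ConvexOn ℝ univ g := by
    have h1 : ConvexOn ℝ univ fun s : ℝ => Real.exp (-s) := by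
      simpa [Function.comp_def] using! convexOn_exp.comp_linearMap (-LinearMap.id : ℝ →ₗ[ℝ] ℝ)
    have h2 : ConvexOn ℝ univ fun s : ℝ => Real.exp ((2 - α) * s) := by
      exact convexOn_exp.comp_linearMap (LinearMap.mul ℝ ℝ (2 - α))
    exact (h1.smul (c := 2) (by norm_num)).add (h2.smul (c := diskConstant α / Real.pi) (by positivity))
  have hdens : ∀ t : ℝ, 0 < t → diskEnergy α t / (Real.pi * t ^ 2) = g (Real.log t) := by
    intro t ht
    simp only [g]
    rw [Real.exp_neg, Real.exp_log ht, mul_comm (2 - α), ← Real.rpow_def_of_pos ht, diskEnergy,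
      unitDiskInteraction_eq hα1, show 4 - α = 2 - α + 2 by ring, Real.rpow_add ht, Real.rpow_two]
    field_simp
  have hr := ha.trans_le har
  rw [hdens r hr, hdens a ha, hdens b (hr.trans_le hrb)]
  exact hg.le_max_of_mem_Icc (mem_univ _) (mem_univ _)
    ⟨Real.log_le_log ha har, Real.log_le_log hr hrb⟩

lemma one_sub_two_rpow_pos {α : ℝ} (hα1 : α ≤ 1) : 0 < 1 - (2 : ℝ) ^ ((α - 2) / 2) :=
  sub_pos.2 (Real.rpow_lt_one_of_one_lt_of_neg one_lt_two (by linarith))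

lemma criticalMass_pos {α : ℝ} (hα1 : α ≤ 1) : 0 < criticalMass α := by
  have h1 := Real.Gamma_pos_of_pos (show 0 < 2 - α by linarith)
  have h2 := Real.Gamma_pos_of_pos (show 0 < 2 - α / 2 by linarith)
  have h3 := Real.Gamma_pos_of_pos (show 0 < 3 - α / 2 by linarith)
  have h4 := one_sub_two_rpow_pos hα1
  have h5 : 0 < √(2 : ℝ) - 1 := sub_pos.2 (Real.lt_sqrt_of_sq_lt (by norm_num))
  have := Real.pi_pos
  unfold criticalMass
  positivity

lemma criticalRadius_pos {α : ℝ} (hα1 : α ≤ 1) : 0 < criticalRadius α :=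
  Real.sqrt_pos.2 (div_pos (criticalMass_pos hα1) Real.pi_pos)

lemma pi_mul_criticalRadius_sq {α : ℝ} (hα1 : α ≤ 1) :
    Real.pi * criticalRadius α ^ 2 = criticalMass α := by
  rw [criticalRadius, Real.sq_sqrt (div_pos (criticalMass_pos hα1) Real.pi_pos).le,
    mul_div_cancel₀ _ Real.pi_ne_zero]

/-- The equation satisfied by the critical radius. -/
lemma diskConstant_mul_criticalRadius_rpow {α : ℝ} (hα1 : α ≤ 1) :
    diskConstant α * (1 - (2 : ℝ) ^ ((α - 2) / 2)) * criticalRadius α ^ (3 - α) =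
      2 * Real.pi * (√2 - 1) := by
  have h1 := Real.Gamma_pos_of_pos (show 0 < 2 - α by linarith)
  have h2 := Real.Gamma_pos_of_pos (show 0 < 2 - α / 2 by linarith)
  have h3 := Real.Gamma_pos_of_pos (show 0 < 3 - α / 2 by linarith)
  have h4 := one_sub_two_rpow_pos hα1
  have h5 : 0 < √(2 : ℝ) - 1 := sub_pos.2 (Real.lt_sqrt_of_sq_lt (by norm_num))
  have hπ := Real.pi_pos
  have h6 : 3 - α ≠ 0 := by linarith
  rw [criticalRadius, criticalMass, mul_div_cancel_left₀ _ Real.pi_ne_zero, Real.sqrt_eq_rpow,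
    ← Real.rpow_mul (by positivity), ← Real.rpow_mul (by positivity),
    show 2 / (3 - α) * (1 / 2 * (3 - α)) = 1 by field_simp, Real.rpow_one, diskConstant]
  generalize 1 - (2 : ℝ) ^ ((α - 2) / 2) = c at h4
  generalize Real.Gamma (2 - α / 2) = g at h2
  generalize Real.Gamma (3 - α / 2) = h at h3
  field_simp

/-- At the critical mass, one disk and two far apart disks of half the mass have the same
energy. -/
lemma diskEnergy_criticalRadius_div_sqrt_two {α : ℝ} (hα1 : α ≤ 1) :
    diskEnergy α (criticalRadius α / √2) / (Real.pi * (criticalRadius α / √2) ^ 2) =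
      criticalDensity α := by
  have hR := criticalRadius_pos hα1
  have hπ := Real.pi_pos
  have hs : 0 < √(2 : ℝ) := by positivity
  have hss : √(2 : ℝ) ^ 2 = 2 := Real.sq_sqrt (by norm_num)
  have key := diskConstant_mul_criticalRadius_rpow hα1
  have hpow : (criticalRadius α / √2) ^ (4 - α) =
      criticalRadius α * criticalRadius α ^ (3 - α) * ((2 : ℝ) ^ ((α - 2) / 2) / 2) := by
    rw [Real.div_rpow hR.le hs.le, show 4 - α = 1 + (3 - α) by ring, Real.rpow_add hR, Real.rpow_one,
      Real.sqrt_eq_rpow, ← Real.rpow_mul zero_le_two, div_eq_mul_inv, ← Real.rpow_neg zero_le_two,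
      ← Real.rpow_sub_one two_ne_zero]
    congr 2
    ring
  have hpow2 : criticalRadius α ^ (4 - α) = criticalRadius α * criticalRadius α ^ (3 - α) := by
    rw [show 4 - α = 1 + (3 - α) by ring, Real.rpow_add hR, Real.rpow_one]
  rw [criticalDensity, diskEnergy, diskEnergy, unitDiskInteraction_eq hα1, hpow, hpow2, div_pow, hss,
    div_eq_div_iff (by positivity) (by positivity)]
  have hdiv : criticalRadius α / √2 = criticalRadius α * √2 / 2 := by
    rw [div_eq_div_iff hs.ne' two_ne_zero, mul_assoc, ← sq, hss]
  rw [hdiv]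
  -- With denominators cleared, equality of the two densities is a multiple of the equation defining
  -- the critical radius.
  linear_combination (-Real.pi * criticalRadius α ^ 3 / 2) * key

/-- Both endpoint densities equal `criticalDensity α`, so the maximum in the quasiconvexity bound
collapses to it. -/
lemma diskEnergy_le_criticalDensity {α r : ℝ} (hα1 : α ≤ 1) (h1 : criticalRadius α / √2 ≤ r)
    (h2 : r ≤ criticalRadius α) :
    diskEnergy α r ≤ Real.pi * r ^ 2 * criticalDensity α := by
  have ha : 0 < criticalRadius α / √2 := div_pos (criticalRadius_pos hα1) (by positivity)
  have h := diskEnergy_div_le_max hα1 ha h1 h2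
  rw [diskEnergy_criticalRadius_div_sqrt_two hα1, ← criticalDensity, max_self,
    div_le_iff₀ (mul_pos Real.pi_pos (pow_pos (ha.trans_le h1) 2))] at h
  linarith

end RieszIsoperimetric

end

/-! ### Choice of the number of disks -/

theorem proposition3p8 (α m : ℝ) (hα : 0 < α) (hα1 : α ≤ 1)
    (hm : RieszIsoperimetric.criticalMass α ≤ m)
    (Ω : Set RieszIsoperimetric.Plane) (hΩ : RieszIsoperimetric.IsMinimizer α m Ω) :
    RieszIsoperimetric.energy α Ω ≤
        ENNReal.ofReal (m * RieszIsoperimetric.criticalDensity α) ∧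
      ENNReal.ofReal (m * RieszIsoperimetric.criticalDensity α) =
        ENNReal.ofReal (m / RieszIsoperimetric.criticalMass α) *
          RieszIsoperimetric.energy α
            (Metric.ball (0 : RieszIsoperimetric.Plane)
              √(RieszIsoperimetric.criticalMass α / Real.pi)) := by
  open RieszIsoperimetric in
  have hc := criticalMass_pos hα1
  have hπ := Real.pi_pos
  have hm0 : 0 < m := hc.trans_le hm
  constructor
  · set n := ⌈m / criticalMass α⌉₊
    have hn0 : 0 < n := Nat.ceil_pos.2 (by positivity)
    have hn : (0 : ℝ) < n := by exact_mod_cast hn0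
    have hn1 : m ≤ n * criticalMass α := by
      rw [← div_le_iff₀ hc]
      exact Nat.le_ceil _
    -- Rounding up adds less than `1`, which is at most `m / criticalMass α`; this is where `m` must
    -- reach the critical mass.
    have hn2 : n * criticalMass α ≤ 2 * m := by
      have h1 : (n : ℝ) < m / criticalMass α + 1 := Nat.ceil_lt_add_one (by positivity)
      have h2 : 1 ≤ m / criticalMass α := (one_le_div hc).2 hm
      rw [← le_div_iff₀ hc, mul_div_assoc]
      linarith
    set r := √(m / n / Real.pi)
    have hr : 0 < r := Real.sqrt_pos.2 (by positivity)
    have hrm : n * (Real.pi * r ^ 2) = m := by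
      rw [Real.sq_sqrt (by positivity)]
      field_simp
    refine (energy_le_of_isMinimizer hα hα1 hΩ n hr hrm).trans (ENNReal.ofReal_le_ofReal ?_)
    have h1 : criticalRadius α / √2 ≤ r := by
      rw [criticalRadius, ← Real.sqrt_div (by positivity)]
      apply Real.sqrt_le_sqrt
      rw [div_right_comm]
      refine div_le_div_of_nonneg_right ?_ hπ.le
      rw [div_le_div_iff₀ two_pos hn]
      linarith
    have h2 : r ≤ criticalRadius α := by
      apply Real.sqrt_le_sqrt
      gcongr
      rw [div_le_iff₀ hn]
      linarith
    calc n * diskEnergy α r ≤ n * (Real.pi * r ^ 2 * criticalDensity α) := by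
          gcongr
          exact diskEnergy_le_criticalDensity hα1 h1 h2
      _ = m * criticalDensity α := by rw [← mul_assoc, hrm]
  -- The equality needs the exact perimeter of the disk; the estimate above uses only its upper
  -- bound.
  · rw [show √(criticalMass α / Real.pi) = criticalRadius α from rfl,
      energy_ball hα1 (criticalRadius_pos hα1), ← ENNReal.ofReal_mul (by positivity),
      criticalDensity, pi_mul_criticalRadius_sq hα1]
    congr 1
    ring
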